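/- **Theorem 1.** Let $R$ be an arbitrary associative ring with $1$, and let $n\ge 4$. For a two-sided ideal $A$ of $R$ let $E(n,A)$ denote the (unrelative) elementary subgroup of level $A$, i.e. the subgroup of $\operatorname{GL}(n,R)$ generated by all matrices $t_{ij}(a)=e+a e_{ij}$ with $1\le i\neq j\le n$ and $a\in A$, where $e$ is the identity matrix and $e_{ij}$ are the standard matrix units. For two subgroups $F,H\le \operatorname{GL}(n,R)$ let $[F,H]$ be the subgroup generated by all commutators $[f,h]=fhf^{-1}h^{-1}$, $f\in F$, $h\in H$; for two-sided ideals $A,B$ let $A\circ B=AB+BA$ (this operation is in general not associative). Let $m\ge 2$, let $I_1,\ldots,I_m$ be two-sided ideals of $R$, and take an arbitrary arrangement of brackets on $m$ letters. It determines a multiple commutator $[\![E(n,I_1),\ldots,E(n,I_m)]\!]$, which is uniquely of the form $$[\![E(n,I_1),\ldots,E(n,I_m)]\!]=\big[[\![E(n,I_1),\ldots,E(n,I_s)]\!],[\![E(n,I_{s+1}),\ldots,E(n,I_m)]\!]\big]$$ according to its outermost pair of brackets, with some cut point $s\in\{1,\ldots,m-1\}$ and with the induced arrangements of brackets on the first $s$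 and on the last $m-s$ letters. Then $$[\![E(n,I_1),E(n,I_2),\ldots,E(n,I_m)]\!]=\big[E(n,I_1\circ\cdots\circ I_s),\,E(n,I_{s+1}\circ\cdots\circ I_m)\big],$$ where the symmetrised products $I_1\circ\cdots\circ I_s$ and $I_{s+1}\circ\cdots\circ I_m$ are bracketed by these two induced arrangements (a single ideal standing for itself if there is only one factor). -/

import Mathlib

/-- The elementary transvection `t_ij(c) = e + c e_ij` (`i ≠ j`) as an element of `GL(n, R)`;
its inverse is `t_ij(-c)`. -/
def elemTransvection {R : Type*} [Ring R] {n : ℕ} (i j : Fin n) (hij : i ≠ j) (c : R) :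
    Matrix.GeneralLinearGroup (Fin n) R where
  val := 1 + Matrix.single i j c
  inv := 1 + Matrix.single i j (-c)
  val_inv := by
    rw [mul_add, add_mul, add_mul, Matrix.single_mul_single_of_ne _ _ _ _ hij.symm, one_mul,
      one_mul, mul_one, add_zero, add_assoc, ← Matrix.single_add, add_neg_cancel, Matrix.single_zero,
      add_zero]
  inv_val := by
    rw [mul_add, add_mul, add_mul, Matrix.single_mul_single_of_ne _ _ _ _ hij.symm, one_mul,
      one_mul, mul_one, add_zero, add_assoc, ← Matrix.single_add, neg_add_cancel, Matrix.single_zero,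
      add_zero]

/-- The unrelative elementary subgroup `E(n, A)` of level `A`: the subgroup of `GL(n, R)`
generated by all `t_ij(a)` with `i ≠ j` and `a ∈ A` (no normal closure is taken). -/
def elemSubgroup {R : Type*} [Ring R] (n : ℕ) (A : Ideal R) :
    Subgroup (Matrix.GeneralLinearGroup (Fin n) R) :=
  Subgroup.closure {g | ∃ (i j : Fin n) (hij : i ≠ j), ∃ a ∈ A, g = elemTransvection i j hij a}

/-- The symmetrised product `A ∘ B = AB + BA`. -/
def symmProd {R : Type*} [Ring R] (A B : Ideal R) : Ideal R :=
  A * B + B * A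

/-- Arrangements of brackets on a word of `m ≥ 1` letters. A bracketing of at least two letters is
`node b c` for unique `b` (on the first `s` letters) and `c` (on the remaining `t` letters);
its cut point is `s`. -/
inductive Bracketing : ℕ → Type
  | leaf : Bracketing 1
  | node {s t : ℕ} (b : Bracketing s) (c : Bracketing t) : Bracketing (s + t)

/-- The value of the bracketed word `x 0, x 1, …, x (m - 1)` under a binary operation `op`. -/
def Bracketing.eval {α : Type*} (op : α → α → α) : {m : ℕ} → Bracketing m → (Fin m → α) → α
  | _, .leaf, x => x 0
  | _, .node (s := s) (t := t) b c, x =>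
      op (b.eval op fun i => x (Fin.castAdd t i)) (c.eval op fun i => x (Fin.natAdd s i))

/-! Write E(A) for the elementary subgroup of level A, E(R,A) for its normal closure in E(R), and
y_ij(a,b) = [x_ij(a), x_ji(b)]. The point is that inside an outer commutator, [E(A),E(B)] may be
replaced by E(A∘B).

The group [E(A),E(B)] contains E(R,A∘B) and is generated by it together with the y_ij(a,b), for a in
A, b in B (`commutator_familySubgroup_eq_closure`). Modulo E(R,A∘B) these y_ij(a,b) are central
(`commute_commutator`) and do not depend on the position (i,j) (`commutator_eq`). As there are at
least four indices, y_ij(a,b) can be moved to a position disjoint from any given (k,l), where it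
commutes with everything built from x_kl and x_lk; only the correction factor from E(R,A∘B)
contributes. This gives `triple_commutator` and `quadruple_commutator`, and an induction on the
bracketing finishes.

Only the Steinberg relations are used, and they survive in quotients, so "modulo E(R,A∘B)" is
literally a computation in a quotient group. -/

open scoped commutatorElement

/-! ### Steinberg families and their subgroups of a given level -/

/-- A family of elements of a group that generates it and satisfies the Steinberg relations,
with at least four indices. -/
structure IsSteinbergFamily {R ι G : Type*} [Ring R] [Fintype ι] [Group G]
    (x : ι → ι → R → G) : Prop where
  four_le : 4 ≤ Fintype.card ι
  add : ∀ {i j : ι}, i ≠ j → ∀ a b : R, x i j (a + b) = x i j a * x i j b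
  comm : ∀ {i j k : ι}, i ≠ j → j ≠ k → i ≠ k → ∀ a b : R, ⁅x i j a, x j k b⁆ = x i k (a * b)
  commute : ∀ {i j k l : ι}, i ≠ j → k ≠ l → j ≠ k → i ≠ l → ∀ a b : R,
    Commute (x i j a) (x k l b)
  closure_eq_top : Subgroup.closure {g | ∃ i j, i ≠ j ∧ ∃ a, g = x i j a} = ⊤

/-- The subgroup generated by the members of the family with arguments in `A`. -/
def familySubgroup {R ι G : Type*} [Ring R] [Group G] (x : ι → ι → R → G) (A : Ideal R) :
    Subgroup G :=
  Subgroup.closure {g | ∃ i j, i ≠ j ∧ ∃ a ∈ A, g = x i j a}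

/-- The normal closure of `familySubgroup x A`. -/
def familyNormal {R ι G : Type*} [Ring R] [Group G] (x : ι → ι → R → G) (A : Ideal R) :
    Subgroup G :=
  Subgroup.normalClosure {g | ∃ i j, i ≠ j ∧ ∃ a ∈ A, g = x i j a}

instance familyNormal_normal {R ι G : Type*} [Ring R] [Group G] (x : ι → ι → R → G)
    (A : Ideal R) : (familyNormal x A).Normal :=
  Subgroup.normalClosure_normal

theorem familySubgroup_le_familyNormal {R ι G : Type*} [Ring R] [Group G] (x : ι → ι → R → G)
    (A : Ideal R) : familySubgroup x A ≤ familyNormal x A :=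
  Subgroup.closure_le_normalClosure

theorem mem_familySubgroup {R ι G : Type*} [Ring R] [Group G] (x : ι → ι → R → G) {A : Ideal R}
    {i j : ι} (hij : i ≠ j) {a : R} (ha : a ∈ A) : x i j a ∈ familySubgroup x A :=
  Subgroup.subset_closure ⟨i, j, hij, a, ha, rfl⟩

theorem mem_familyNormal {R ι G : Type*} [Ring R] [Group G] (x : ι → ι → R → G) {A : Ideal R}
    {i j : ι} (hij : i ≠ j) {a : R} (ha : a ∈ A) : x i j a ∈ familyNormal x A :=
  familySubgroup_le_familyNormal x A (mem_familySubgroup x hij ha)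

/-- The subgroup generated by the conjugates of `x i j a` by `x j i r`, for `a ∈ A`. -/
def conjSubgroup {R ι G : Type*} [Ring R] [Group G] (x : ι → ι → R → G) (A : Ideal R) :
    Subgroup G :=
  Subgroup.closure {g | ∃ i j, i ≠ j ∧ ∃ a ∈ A, ∃ r, g = MulAut.conj (x j i r) (x i j a)}

theorem mul_mem_symmProd {R : Type*} [Ring R] {A B : Ideal R} {a b : R} (ha : a ∈ A)
    (hb : b ∈ B) : a * b ∈ symmProd A B ∧ b * a ∈ symmProd A B :=
  ⟨Ideal.mem_sup_left (Ideal.mul_mem_mul ha hb), Ideal.mem_sup_right (Ideal.mul_mem_mul hb ha)⟩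

theorem symmProd_induction {R : Type*} [Ring R] {A B : Ideal R} {p : R → Prop}
    (hab : ∀ a ∈ A, ∀ b ∈ B, p (a * b)) (hba : ∀ b ∈ B, ∀ a ∈ A, p (b * a))
    (hadd : ∀ c d, p c → p d → p (c + d)) {c : R} (hc : c ∈ symmProd A B) : p c := by
  obtain ⟨u, hu, v, hv, rfl⟩ := Submodule.mem_sup.1 hc
  exact hadd _ _ (Submodule.smul_induction_on hu hab hadd) (Submodule.smul_induction_on hv hba hadd)

theorem isTwoSided_symmProd {R : Type*} [Ring R] {A B : Ideal R} (hA : A.IsTwoSided)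
    (hB : B.IsTwoSided) : (symmProd A B).IsTwoSided := by
  refine ⟨fun r hc => ?_⟩
  refine symmProd_induction (p := fun c => c * r ∈ symmProd A B) ?_ ?_ ?_ hc
  · intro a ha b hb
    rw [mul_assoc]
    exact (mul_mem_symmProd ha (B.mul_mem_right r hb)).1
  · intro b hb a ha
    rw [mul_assoc]
    exact (mul_mem_symmProd (A.mul_mem_right r ha) hb).2
  · intro c d hc hd
    rw [add_mul]
    exact add_mem hc hd

theorem commute_mk_iff {G : Type*} [Group G] (N : Subgroup G) [N.Normal] {g h : G} :
    Commute (g : G ⧸ N) (h : G ⧸ N) ↔ ⁅g, h⁆ ∈ N := by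
  rw [← commutatorElement_eq_one_iff_commute, ← QuotientGroup.eq_one_iff]
  rfl

/-- Modulo N, the elements commuting with a fixed one form a subgroup. Normality of N is what makes
checking on generators enough. -/
theorem commutator_closure_le {G : Type*} [Group G] {N : Subgroup G} [N.Normal] {S T : Set G}
    (h : ∀ s ∈ S, ∀ t ∈ T, ⁅s, t⁆ ∈ N) :
    ⁅Subgroup.closure S, Subgroup.closure T⁆ ≤ N := by
  rw [Subgroup.commutator_le]
  intro g hg k hk
  rw [← commute_mk_iff]
  induction hg using Subgroup.closure_induction with
  | mem s hs =>
    induction hk using Subgroup.closure_induction with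
    | mem t ht => exact (commute_mk_iff N).2 (h s hs t ht)
    | one => exact Commute.one_right _
    | mul u v _ _ hu hv => exact hu.mul_right hv
    | inv u _ hu => exact hu.inv_right
  | one => exact Commute.one_left _
  | mul u v _ _ hu hv => exact hu.mul_left hv
  | inv u _ hu => exact hu.inv_left

theorem conj_mem_conjSubgroup {R ι G : Type*} [Ring R] [Group G] {x : ι → ι → R → G}
    {A : Ideal R} {i j : ι} (hij : i ≠ j) {a : R} (ha : a ∈ A) (r : R) :
    MulAut.conj (x j i r) (x i j a) ∈ conjSubgroup x A :=
  Subgroup.subset_closure ⟨i, j, hij, a, ha, r, rfl⟩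

/-! ### Steinberg calculus and generators of the normal closure -/

namespace IsSteinbergFamily

variable {R ι G : Type*} [Ring R] [Fintype ι] [Group G] {x : ι → ι → R → G}

theorem exists_disjoint (hx : IsSteinbergFamily x) (i j : ι) :
    ∃ p q : ι, p ≠ q ∧ p ≠ i ∧ p ≠ j ∧ q ≠ i ∧ q ≠ j := by
  classical
  have h : 1 < (({i, j} : Finset ι)ᶜ).card := by
    rw [Finset.card_compl]
    have := Finset.card_le_two (a := i) (b := j)
    have := hx.four_le
    omega
  obtain ⟨p, hp, q, hq, hpq⟩ := Finset.one_lt_card.1 h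
  simp at hp hq
  exact ⟨p, q, hpq, hp.1, hp.2, hq.1, hq.2⟩

theorem exists_third (hx : IsSteinbergFamily x) (i j : ι) : ∃ k : ι, k ≠ i ∧ k ≠ j := by
  obtain ⟨k, _, _, h⟩ := hx.exists_disjoint i j
  exact ⟨k, h.1, h.2.1⟩

theorem zero (hx : IsSteinbergFamily x) {i j : ι} (hij : i ≠ j) : x i j 0 = 1 := by
  have := hx.add hij 0 0
  rw [add_zero] at this
  exact left_eq_mul.1 this

theorem neg (hx : IsSteinbergFamily x) {i j : ι} (hij : i ≠ j) (a : R) :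
    x i j (-a) = (x i j a)⁻¹ := by
  rw [eq_inv_iff_mul_eq_one, ← hx.add hij, neg_add_cancel, hx.zero hij]

theorem conj_left (hx : IsSteinbergFamily x) {i j k : ι} (hij : i ≠ j) (hjk : j ≠ k)
    (hik : i ≠ k) (a b : R) :
    MulAut.conj (x i j a) (x j k b) = x i k (a * b) * x j k b := by
  rw [← hx.comm hij hjk hik, MulAut.conj_apply, commutatorElement_def]
  group

theorem conj_right (hx : IsSteinbergFamily x) {i j k : ι} (hij : i ≠ j) (hjk : j ≠ k)
    (hik : i ≠ k) (a b : R) :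
    MulAut.conj (x j k b) (x i j a) = x i k (-(a * b)) * x i j a := by
  rw [hx.neg hik, ← hx.comm hij hjk hik, MulAut.conj_apply, commutatorElement_def]
  group

theorem conj_commute (hx : IsSteinbergFamily x) {i j k l : ι} (hij : i ≠ j) (hkl : k ≠ l)
    (hjk : j ≠ k) (hil : i ≠ l) (a b : R) :
    MulAut.conj (x i j a) (x k l b) = x k l b := by
  rw [MulAut.conj_apply, (hx.commute hij hkl hjk hil a b).eq, mul_inv_cancel_right]

theorem mem_normal_of_conj (hx : IsSteinbergFamily x) {S : Set G}
    (h : ∀ k l, k ≠ l → ∀ s, ∀ g ∈ S, MulAut.conj (x k l s) g ∈ Subgroup.closure S) :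
    (Subgroup.closure S).Normal := by
  refine ⟨fun g hg u => ?_⟩
  have hu : u ∈ Subgroup.closure {g | ∃ i j, i ≠ j ∧ ∃ a, g = x i j a} := by
    rw [hx.closure_eq_top]; trivial
  have key : ∀ k l, k ≠ l → ∀ s, ∀ g ∈ Subgroup.closure S,
      MulAut.conj (x k l s) g ∈ Subgroup.closure S := by
    intro k l hkl s g hg
    induction hg using Subgroup.closure_induction with
    | mem g hg => exact h k l hkl s g hg
    | one => rw [map_one]; exact one_mem _
    | mul a b _ _ ha hb => rw [map_mul]; exact mul_mem ha hb
    | inv a _ ha => rw [map_inv]; exact inv_mem ha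
  rw [← MulAut.conj_apply]
  induction hu using Subgroup.closure_induction_left generalizing g with
  | one => simpa using hg
  | mul_left y hy z hz ih =>
    obtain ⟨i, j, hij, a, rfl⟩ := hy
    rw [map_mul]
    exact key i j hij a _ (ih g hg)
  | inv_mul_cancel y hy z hz ih =>
    obtain ⟨i, j, hij, a, rfl⟩ := hy
    rw [map_mul, ← hx.neg hij]
    exact key i j hij _ _ (ih g hg)

theorem quotient (hx : IsSteinbergFamily x) (N : Subgroup G) [N.Normal] :
    IsSteinbergFamily fun i j a => (x i j a : G ⧸ N) where
  four_le := hx.four_le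
  add hij a b := by rw [hx.add hij]; rfl
  comm hij hjk hik a b := by rw [← hx.comm hij hjk hik]; rfl
  commute hij hkl hjk hil a b := (hx.commute hij hkl hjk hil a b).map (QuotientGroup.mk' N)
  closure_eq_top := by
    have h := congrArg (Subgroup.map (QuotientGroup.mk' N)) hx.closure_eq_top
    rw [MonoidHom.map_closure, ← MonoidHom.range_eq_map,
      MonoidHom.range_eq_top.2 (QuotientGroup.mk'_surjective N)] at h
    rw [← h]
    congr 1
    ext g
    constructor
    · rintro ⟨i, j, hij, a, rfl⟩
      exact ⟨_, ⟨i, j, hij, a, rfl⟩, rfl⟩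
    · rintro ⟨_, ⟨i, j, hij, a, rfl⟩, rfl⟩
      exact ⟨i, j, hij, a, rfl⟩

theorem mem_conjSubgroup (hx : IsSteinbergFamily x) {A : Ideal R} {i j : ι} (hij : i ≠ j)
    {a : R} (ha : a ∈ A) : x i j a ∈ conjSubgroup x A := by
  simpa [hx.zero hij.symm] using conj_mem_conjSubgroup (x := x) hij ha 0

/-- Moving x_kl(s) past x_ji(r) costs a commutator that is trivial or again a generator in row j or
column i. Those generators commute with x_ji(r), and conjugating by them only adds factors of level
A. Position (i,j) is excluded, since there [x_ij(s), x_ji(r)] is not elementary. -/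
theorem conj_conj_mem (hx : IsSteinbergFamily x) {A : Ideal R} (hA : A.IsTwoSided)
    {i j k l : ι} (hij : i ≠ j) (hkl : k ≠ l) (hne : ¬ (k = i ∧ l = j)) {a : R} (ha : a ∈ A)
    (r s : R) :
    MulAut.conj (x k l s) (MulAut.conj (x j i r) (x i j a)) ∈ conjSubgroup x A := by
  have hz := conj_mem_conjSubgroup (x := x) hij ha r
  have mem : ∀ {p q : ι}, p ≠ q → ∀ {c}, c ∈ A → x p q c ∈ conjSubgroup x A :=
    fun h _ hc => hx.mem_conjSubgroup h hc
  have swap : ∀ {g h w : G}, MulAut.conj g (MulAut.conj h w) =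
      MulAut.conj ⁅g, h⁆ (MulAut.conj h (MulAut.conj g w)) := by
    intro g h w
    simp only [MulAut.conj_apply, commutatorElement_def]
    group
  have row : ∀ {k : ι}, k ≠ i → k ≠ j → ∀ s : R,
      MulAut.conj (x j k s) (MulAut.conj (x j i r) (x i j a)) ∈ conjSubgroup x A := by
    intro k hki hkj s
    rw [swap, commutatorElement_eq_one_iff_commute.2
      (hx.commute hkj.symm hij.symm hkj hij.symm s r), map_one, MulAut.one_apply,
      hx.conj_right hij hkj.symm hki.symm, map_mul, hx.conj_left hij.symm hki.symm hkj.symm]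
    exact mul_mem (mul_mem (mem hkj.symm (A.mul_mem_left _ (A.neg_mem (A.mul_mem_right _ ha))))
      (mem hki.symm (A.neg_mem (A.mul_mem_right _ ha)))) hz
  have col : ∀ {k : ι}, k ≠ i → k ≠ j → ∀ s : R,
      MulAut.conj (x k i s) (MulAut.conj (x j i r) (x i j a)) ∈ conjSubgroup x A := by
    intro k hki hkj s
    rw [swap, commutatorElement_eq_one_iff_commute.2
      (hx.commute hki hij.symm hij hki s r), map_one, MulAut.one_apply,
      hx.conj_left hki hij hkj, map_mul, hx.conj_right hkj hij.symm hki]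
    exact mul_mem (mul_mem (mem hki (A.neg_mem (A.mul_mem_right _ (A.mul_mem_left _ ha))))
      (mem hkj (A.mul_mem_left _ ha))) hz
  by_cases hki : k = i
  · subst hki
    have hlj : l ≠ j := fun h => hne ⟨rfl, h⟩
    rw [swap, hx.conj_commute hkl hij hkl.symm hij, ← commutatorElement_inv,
      hx.comm hij.symm hkl hlj.symm, ← hx.neg hlj.symm]
    exact row hkl.symm hlj _
  by_cases hkj : k = j
  · subst hkj
    by_cases hli : l = i
    · subst hli
      rw [← MulAut.mul_apply, ← map_mul, ← hx.add hkl]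
      exact conj_mem_conjSubgroup hij ha _
    · exact row hli hkl.symm s
  by_cases hli : l = i
  · subst hli
    exact col hki hkj s
  by_cases hlj : l = j
  · subst hlj
    rw [swap, hx.conj_commute hkl hij hij.symm hkl, hx.comm hkj hij.symm hki]
    exact col hki hkj _
  · rw [swap, hx.conj_commute hkl hij hli hkj, commutatorElement_eq_one_iff_commute.2
      (hx.commute hkl hij.symm hlj hki s r), map_one, MulAut.one_apply]
    exact hz

/-- Conjugate x_ij(ab) = [x_ik(a), x_kj(b)] entrywise. The opposite pair of positions disappears,
leaving only products from column k and row k. -/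
theorem conj_eq_commutator (hx : IsSteinbergFamily x) {i j k : ι} (hij : i ≠ j) (hki : k ≠ i)
    (hkj : k ≠ j) (a b r : R) :
    MulAut.conj (x j i r) (x i j (a * b)) =
      ⁅x j k (r * a) * x i k a, x k i (-(b * r)) * x k j b⁆ := by
  rw [← hx.comm hki.symm hkj hij, map_commutatorElement, hx.conj_left hij.symm hki.symm hkj.symm,
    hx.conj_right hkj hij.symm hki]

theorem conjSubgroup_normal (hx : IsSteinbergFamily x) {A : Ideal R} (hA : A.IsTwoSided) :
    (conjSubgroup x A).Normal := by
  refine hx.mem_normal_of_conj ?_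
  rintro k l hkl s _ ⟨i, j, hij, a, ha, r, rfl⟩
  change _ ∈ conjSubgroup x A
  by_cases hne : i = k ∧ j = l
  swap
  · exact hx.conj_conj_mem hA hij hkl (fun h => hne ⟨h.1.symm, h.2.symm⟩) ha r s
  obtain ⟨rfl, rfl⟩ := hne
  obtain ⟨k, hki, hkj⟩ := hx.exists_third i j
  have mem : ∀ {p q : ι}, p ≠ q → ∀ {c}, c ∈ A → x p q c ∈ conjSubgroup x A :=
    fun h _ hc => hx.mem_conjSubgroup h hc
  have h1 : ∀ p q, ∀ c ∈ A, MulAut.conj (x k i p * x k j q) (x j k c) ∈ conjSubgroup x A := by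
    intro p q c hc
    rw [map_mul, MulAut.mul_apply]
    exact hx.conj_conj_mem hA hkj.symm hki (fun h => hkj h.1) hc _ _
  have h2 : ∀ p q, ∀ c ∈ A, MulAut.conj (x k i p * x k j q) (x i k c) ∈ conjSubgroup x A := by
    intro p q c hc
    rw [(hx.commute hki hkj hki.symm hkj p q).eq, map_mul, MulAut.mul_apply]
    exact hx.conj_conj_mem hA hki.symm hkj (fun h => hki h.1) hc _ _
  have hra : r * a ∈ A := A.mul_mem_left _ ha
  have hu : MulAut.conj (x i j s) (x j k (r * a) * x i k a) =
      x i k (s * (r * a)) * x j k (r * a) * x i k a := by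
    rw [map_mul, hx.conj_left hij hkj.symm hki.symm, hx.conj_commute hij hki.symm hij.symm hki.symm]
  have hv : MulAut.conj (x i j s) (x k i (-(1 * r)) * x k j 1) =
      x k i (-(1 * r)) * x k j (-(-(1 * r) * s) + 1) := by
    rw [map_mul, hx.conj_right hki hij hkj, hx.conj_commute hij hkj hkj.symm hij,
      (hx.commute hkj hki hkj.symm hki _ _).eq, mul_assoc, ← hx.add hkj]
  -- The excluded position: with a = a·1 the generator becomes [u,v], with u in column k of level A
  -- and v in row k. Conjugation by x_ij(s) keeps this shape, and in [u,v] = u(vuv⁻¹)⁻¹ each factor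
  -- of vuv⁻¹ falls under `conj_conj_mem`.
  rw [← mul_one a, hx.conj_eq_commutator hij hki hkj, map_commutatorElement, hu, hv]
  have e : ∀ u v : G, ⁅u, v⁆ = u * (MulAut.conj v u)⁻¹ := by
    intro u v
    rw [MulAut.conj_apply, commutatorElement_def]
    group
  rw [e, map_mul, map_mul]
  exact mul_mem (mul_mem (mul_mem (mem hki.symm (A.mul_mem_left _ hra)) (mem hkj.symm hra))
    (mem hki.symm ha)) (inv_mem (mul_mem (mul_mem (h2 _ _ _ (A.mul_mem_left _ hra))
    (h1 _ _ _ hra)) (h2 _ _ _ ha)))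

theorem familyNormal_eq (hx : IsSteinbergFamily x) {A : Ideal R} (hA : A.IsTwoSided) :
    familyNormal x A = conjSubgroup x A := by
  apply le_antisymm
  · have := hx.conjSubgroup_normal hA
    refine Subgroup.normalClosure_le_normal ?_
    rintro _ ⟨i, j, hij, a, ha, rfl⟩
    exact hx.mem_conjSubgroup hij ha
  · refine (Subgroup.closure_le _).2 ?_
    rintro _ ⟨i, j, hij, a, ha, r, rfl⟩
    exact (familyNormal_normal x A).conj_mem _ (mem_familyNormal x hij ha) _

/-- By `familyNormal_eq` it suffices to treat conjugates of x_ij(ab) by x_ji(r), and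
`conj_eq_commutator` displays these as commutators: ra stays in A and br in B. -/
theorem familyNormal_symmProd_le (hx : IsSteinbergFamily x) {A B : Ideal R} (hA : A.IsTwoSided)
    (hB : B.IsTwoSided) :
    familyNormal x (symmProd A B) ≤ ⁅familySubgroup x A, familySubgroup x B⁆ := by
  have key : ∀ {A B : Ideal R}, A.IsTwoSided → B.IsTwoSided → ∀ {i j : ι}, i ≠ j → ∀ r,
      ∀ a ∈ A, ∀ b ∈ B, MulAut.conj (x j i r) (x i j (a * b)) ∈
        ⁅familySubgroup x A, familySubgroup x B⁆ := by
    intro A B hA hB i j hij r a ha b hb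
    obtain ⟨k, hki, hkj⟩ := hx.exists_third i j
    rw [hx.conj_eq_commutator hij hki hkj]
    exact Subgroup.commutator_mem_commutator
      (mul_mem (mem_familySubgroup x hkj.symm (A.mul_mem_left _ ha))
        (mem_familySubgroup x hki.symm ha))
      (mul_mem (mem_familySubgroup x hki (B.neg_mem (B.mul_mem_right _ hb)))
        (mem_familySubgroup x hkj hb))
  rw [hx.familyNormal_eq (isTwoSided_symmProd hA hB)]
  refine (Subgroup.closure_le _).2 ?_
  rintro _ ⟨i, j, hij, c, hc, r, rfl⟩
  refine symmProd_induction (p := fun c => MulAut.conj (x j i r) (x i j c) ∈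
    ⁅familySubgroup x A, familySubgroup x B⁆) (key hA hB hij r) ?_ ?_ hc
  · rw [Subgroup.commutator_comm]
    exact key hB hA hij r
  · intro c d hc hd
    rw [hx.add hij, map_mul]
    exact mul_mem hc hd

/-! ### Elementary commutators when level A∘B is trivial -/

theorem commute_of_commute_family (hx : IsSteinbergFamily x) {g : G}
    (h : ∀ i j, i ≠ j → ∀ a, Commute g (x i j a)) (k : G) : Commute g k := by
  have hk : k ∈ Subgroup.closure {g | ∃ i j, i ≠ j ∧ ∃ a, g = x i j a} := by
    rw [hx.closure_eq_top]; trivial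
  induction hk using Subgroup.closure_induction with
  | mem t ht =>
    obtain ⟨i, j, hij, a, rfl⟩ := ht
    exact h i j hij a
  | one => exact Commute.one_right _
  | mul u v _ _ hu hv => exact hu.mul_right hv
  | inv u _ hu => exact hu.inv_right

/-- Conjugating a generator that shares one index with {i,j} yields only factors that cancel or have
an argument divisible by ab or ba. -/
theorem commute_commutator (hx : IsSteinbergFamily x) {a b : R} (hab : ∀ r, ∀ i j, i ≠ j →
    x i j (a * b * r) = 1 ∧ x i j (r * (a * b)) = 1 ∧
    x i j (b * a * r) = 1 ∧ x i j (r * (b * a)) = 1)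
    {i j : ι} (hij : i ≠ j) (g : G) : Commute ⁅x i j a, x j i b⁆ g := by
  have comm_of : ∀ {g h : G}, MulAut.conj g h = h → Commute g h := by
    intro g h e
    rwa [MulAut.conj_apply, mul_inv_eq_iff_eq_mul] at e
  have row : ∀ {a b : R}, (∀ r, ∀ i j, i ≠ j → x i j (a * b * r) = 1) →
      ∀ {i j k : ι}, i ≠ j → k ≠ i → k ≠ j → ∀ r,
      Commute ⁅x i j a, x j i b⁆ (x i k r) := by
    intro a b hab i j k hij hki hkj r
    apply comm_of
    have h0 : x i k (-a * (-b * r)) = 1 := by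
      simpa [mul_assoc] using hab r i k hki.symm
    have hk : MulAut.conj (x j i b) (x j k (-b * r)) = x j k (-b * r) :=
      hx.conj_commute hij.symm hkj.symm hij hkj.symm _ _
    rw [commutatorElement_def, ← hx.neg hij, ← hx.neg hij.symm]
    simp only [map_mul, MulAut.mul_apply, hx.conj_left hij.symm hki.symm hkj.symm,
      hx.conj_left hij hkj.symm hki.symm, h0, one_mul,
      hx.conj_commute hij hki.symm hij.symm hki.symm, hk]
    have h1 : x i k (a * (-b * r)) = 1 := by
      simpa [mul_assoc, hx.neg hki.symm] using hab r i k hki.symm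
    have h2 : x i k (a * (b * r)) = 1 := by
      simpa [mul_assoc] using hab r i k hki.symm
    rw [h1, h2, one_mul, one_mul, ← mul_assoc, ← hx.add hkj.symm, neg_mul, neg_add_cancel,
      hx.zero hkj.symm, one_mul]
  have col : ∀ {a b : R}, (∀ r, ∀ i j, i ≠ j → x i j (r * (a * b)) = 1) →
      ∀ {i j k : ι}, i ≠ j → k ≠ i → k ≠ j → ∀ r,
      Commute ⁅x i j a, x j i b⁆ (x k i r) := by
    intro a b hab i j k hij hki hkj r
    apply comm_of
    have h0 : x k i (-(-(r * -a) * b)) = 1 := by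
      simpa [mul_assoc, hx.neg hki] using hab r k i hki
    have hk : MulAut.conj (x i j a) (x k j (-(r * -a))) = x k j (-(r * -a)) :=
      hx.conj_commute hij hkj hkj.symm hij _ _
    rw [commutatorElement_def, ← hx.neg hij, ← hx.neg hij.symm]
    simp only [map_mul, MulAut.mul_apply, hx.conj_right hki hij hkj,
      hx.conj_right hkj hij.symm hki, h0, one_mul,
      hx.conj_commute hij.symm hki hki.symm hij.symm, hk]
    rw [← mul_assoc, ← hx.add hkj, mul_neg, neg_neg, add_neg_cancel, hx.zero hkj, one_mul]
  have inv : ∀ {a b : R} {i j : ι} {g : G}, Commute ⁅x j i b, x i j a⁆ g →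
      Commute ⁅x i j a, x j i b⁆ g := by
    intro a b i j g h
    rw [← commutatorElement_inv]
    exact h.inv_left
  have most : ∀ {k l : ι}, k ≠ l → ¬ ((k = i ∧ l = j) ∨ (k = j ∧ l = i)) → ∀ r,
      Commute ⁅x i j a, x j i b⁆ (x k l r) := by
    intro k l hkl hne r
    by_cases hki : k = i
    · subst hki
      exact row (fun r i j h => (hab r i j h).1) hij hkl.symm (fun h => hne (.inl ⟨rfl, h⟩)) r
    by_cases hkj : k = j
    · subst hkj
      exact inv (row (fun r i j h => (hab r i j h).2.2.1) hij.symm hkl.symm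
        (fun h => hne (.inr ⟨rfl, h⟩)) r)
    by_cases hli : l = i
    · subst hli
      exact col (fun r i j h => (hab r i j h).2.1) hij hki hkj r
    by_cases hlj : l = j
    · subst hlj
      exact inv (col (fun r i j h => (hab r i j h).2.2.2) hij.symm hkj hki r)
    have h1 := hx.commute hij hkl (Ne.symm hkj) (Ne.symm hli) a r
    have h2 := hx.commute hij.symm hkl (Ne.symm hki) (Ne.symm hlj) b r
    exact ((h1.mul_left h2).mul_left h1.inv_left).mul_left h2.inv_left
  refine hx.commute_of_commute_family (fun k l hkl r => ?_) g
  by_cases hne : (k = i ∧ l = j) ∨ (k = j ∧ l = i)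
  swap
  · exact most hkl hne r
  -- Positions (i,j) and (j,i) reduce to the others through x_kl(r) = [x_km(r), x_ml(1)].
  obtain ⟨m, hmk, hml⟩ := hx.exists_third k l
  have h1 := most hmk.symm (r := r) (by grind)
  have h2 := most hml (r := 1) (by grind)
  rw [← mul_one r, ← hx.comm hmk.symm hml hkl]
  exact ((h1.mul_right h2).mul_right h1.inv_right).mul_right h2.inv_right

end IsSteinbergFamily

theorem quotient_mk_eq_one_of_symmProd_le {R ι G : Type*} [Ring R] [Group G] {x : ι → ι → R → G}
    {A B : Ideal R} (hA : A.IsTwoSided) (hB : B.IsTwoSided)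
    {a b : R} (ha : a ∈ A) (hb : b ∈ B) (N : Subgroup G) [N.Normal]
    (hN : familySubgroup x (symmProd A B) ≤ N) (r : R) (i j : ι) (hij : i ≠ j) :
    (x i j (a * b * r) : G ⧸ N) = 1 ∧ (x i j (r * (a * b)) : G ⧸ N) = 1 ∧
      (x i j (b * a * r) : G ⧸ N) = 1 ∧ (x i j (r * (b * a)) : G ⧸ N) = 1 := by
  have := isTwoSided_symmProd hA hB
  have hab := mul_mem_symmProd ha hb
  have key : ∀ {c}, c ∈ symmProd A B → (x i j c : G ⧸ N) = 1 := fun hc =>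
    (QuotientGroup.eq_one_iff _).2 (hN (mem_familySubgroup x hij hc))
  exact ⟨key (Ideal.mul_mem_right _ _ hab.1), key (Ideal.mul_mem_left _ _ hab.1),
    key (Ideal.mul_mem_right _ _ hab.2), key (Ideal.mul_mem_left _ _ hab.2)⟩

/-- The commutators `⁅x i j a, x j i b⁆` with `a ∈ A` and `b ∈ B`. -/
def elemCommutators {R ι G : Type*} [Ring R] [Group G] (x : ι → ι → R → G) (A B : Ideal R) : Set G :=
  {g | ∃ i j, i ≠ j ∧ ∃ a ∈ A, ∃ b ∈ B, g = ⁅x i j a, x j i b⁆}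

namespace IsSteinbergFamily

variable {R ι G : Type*} [Ring R] [Fintype ι] [Group G] {x : ι → ι → R → G}

/-- Computing the conjugate of x_ij(a) by x_ji(b) through `conj_eq_commutator` gives x_ij(a)
y_ik(a,-b), up to conjugating the central second factor. Hence y_ij(a,b) = y_ik(a,-b)⁻¹, which by
centrality is y_ik(a,b). -/
theorem commutator_eq_of_ne_right (hx : IsSteinbergFamily x) {a b : R}
    (hab : ∀ r, ∀ i j, i ≠ j → x i j (a * b * r) = 1 ∧ x i j (r * (a * b)) = 1 ∧
      x i j (b * a * r) = 1 ∧ x i j (r * (b * a)) = 1)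
    {i j k : ι} (hij : i ≠ j) (hki : k ≠ i) (hkj : k ≠ j) :
    ⁅x i j a, x j i b⁆ = ⁅x i k a, x k i b⁆ := by
  have h0 : x j k (b * a) = 1 := by simpa using (hab 1 j k hkj.symm).2.2.1
  have h1 := hx.conj_eq_commutator hij hki hkj a 1 b
  rw [mul_one, h0, one_mul, one_mul, (hx.commute hki hkj hki.symm hkj _ _).eq] at h1
  have h2 : ⁅x i k a, x k j 1 * x k i (-b)⁆ =
      x i j a * (x k j 1 * ⁅x i k a, x k i (-b)⁆ * (x k j 1)⁻¹) := by
    rw [← mul_one a, ← hx.comm hki.symm hkj hij, mul_one]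
    simp only [commutatorElement_def]
    group
  have hab' : ∀ r, ∀ i j, i ≠ j → x i j (a * -b * r) = 1 ∧ x i j (r * (a * -b)) = 1 ∧
      x i j (-b * a * r) = 1 ∧ x i j (r * (-b * a)) = 1 := by
    intro r i j hij
    simpa [hx.neg hij] using hab r i j hij
  have hc := hx.commute_commutator hab' hki.symm
  rw [h2, ← (hc (x k j 1)).eq, mul_inv_cancel_right] at h1
  have h3 : ⁅x j i b, x i j a⁆ = ⁅x i k a, x k i (-b)⁆ := by
    rw [commutatorElement_def, ← MulAut.conj_apply, h1, ← (hc _).eq, mul_inv_cancel_right]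
  have h4 : ⁅x i k a, x k i b⁆ = x k i b * ⁅x i k a, x k i (-b)⁆⁻¹ * (x k i b)⁻¹ := by
    rw [hx.neg hki]
    simp only [commutatorElement_def]
    group
  rw [h4, ← (hc _).inv_left.eq, mul_inv_cancel_right, ← h3, commutatorElement_inv]

theorem commutator_eq (hx : IsSteinbergFamily x) {a b : R}
    (hab : ∀ r, ∀ i j, i ≠ j → x i j (a * b * r) = 1 ∧ x i j (r * (a * b)) = 1 ∧
      x i j (b * a * r) = 1 ∧ x i j (r * (b * a)) = 1)
    {i j k l : ι} (hij : i ≠ j) (hkl : k ≠ l) :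
    ⁅x i j a, x j i b⁆ = ⁅x k l a, x l k b⁆ := by
  have hba : ∀ r, ∀ i j, i ≠ j → x i j (b * a * r) = 1 ∧ x i j (r * (b * a)) = 1 ∧
      x i j (a * b * r) = 1 ∧ x i j (r * (a * b)) = 1 := by
    intro r i j hij
    obtain ⟨h1, h2, h3, h4⟩ := hab r i j hij
    exact ⟨h3, h4, h1, h2⟩
  have right : ∀ {i j k : ι}, i ≠ j → i ≠ k → ⁅x i j a, x j i b⁆ = ⁅x i k a, x k i b⁆ := by
    intro i j k hij hik
    by_cases hkj : k = j
    · rw [hkj]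
    · exact hx.commutator_eq_of_ne_right hab hij hik.symm hkj
  have left : ∀ {i j k : ι}, i ≠ j → k ≠ j → ⁅x i j a, x j i b⁆ = ⁅x k j a, x j k b⁆ := by
    intro i j k hij hkj
    by_cases hki : k = i
    · rw [hki]
    · rw [← commutatorElement_inv, hx.commutator_eq_of_ne_right hba hij.symm hkj hki,
        commutatorElement_inv]
  -- The path (i,j), (i,m), (k,m), (k,l) changes one index at a time and avoids the diagonal.
  obtain ⟨m, hmi, hmk⟩ := hx.exists_third i k
  rw [right hij hmi.symm, left hmi.symm hmk.symm, right hmk.symm hkl]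

theorem commutator_mem (hx : IsSteinbergFamily x) {A B : Ideal R} (hA : A.IsTwoSided)
    (hB : B.IsTwoSided) {g : G} (hg : g ∈ elemCommutators x A B) (h : G) :
    ⁅h, g⁆ ∈ familyNormal x (symmProd A B) := by
  obtain ⟨i, j, hij, a, ha, b, hb, rfl⟩ := hg
  rw [← commute_mk_iff]
  exact ((hx.quotient (familyNormal x (symmProd A B))).commute_commutator
    (quotient_mk_eq_one_of_symmProd_le hA hB ha hb _ (familySubgroup_le_familyNormal x _)) hij _).symm

theorem exists_eq_mul (hx : IsSteinbergFamily x) {A B : Ideal R} (hA : A.IsTwoSided)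
    (hB : B.IsTwoSided) {i j k l : ι} (hij : i ≠ j) (hkl : k ≠ l) {a b : R} (ha : a ∈ A)
    (hb : b ∈ B) :
    ∃ z ∈ familyNormal x (symmProd A B), ⁅x i j a, x j i b⁆ = ⁅x k l a, x l k b⁆ * z := by
  refine ⟨⁅x k l a, x l k b⁆⁻¹ * ⁅x i j a, x j i b⁆, ?_, by rw [mul_inv_cancel_left]⟩
  rw [← QuotientGroup.eq]
  exact (hx.quotient (familyNormal x (symmProd A B))).commutator_eq
    (quotient_mk_eq_one_of_symmProd_le hA hB ha hb _ (familySubgroup_le_familyNormal x _)) hkl hij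

/-! ### The commutator of two elementary subgroups -/

/-- Normally the conjugation is shifted onto x_ij(a), which stays a product of level A. If the
positions coincide this fails, so the conjugate is written as u(vuv⁻¹)⁻¹ with u of level B, and
conjugation by v⁻¹, from row m, is shifted instead. -/
theorem commute_conj (hx : IsSteinbergFamily x) {A B : Ideal R} (hA : A.IsTwoSided)
    (hc : ∀ i j, i ≠ j → ∀ k l, k ≠ l → ∀ a ∈ A, ∀ b ∈ B, Commute (x i j a) (x k l b))
    {i j k l : ι} (hij : i ≠ j) (hkl : k ≠ l) {a b : R} (ha : a ∈ A) (hb : b ∈ B) (r : R) :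
    Commute (x i j a) (MulAut.conj (x l k r) (x k l b)) := by
  have conj_iff : ∀ {g u v : G}, Commute (MulAut.conj g⁻¹ u) v →
      Commute u (MulAut.conj g v) := by
    intro g u v huv
    have := huv.map (MulAut.conj g).toMonoidHom
    simpa [mul_assoc] using this
  by_cases h : i = k ∧ j = l
  · obtain ⟨rfl, rfl⟩ := h
    obtain ⟨m, hmi, hmj⟩ := hx.exists_third i j
    have hrb : r * b ∈ B := B.mul_mem_left _ hb
    have e : ∀ u v : G, ⁅u, v⁆ = u * (MulAut.conj v u)⁻¹ := by
      intro u v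
      rw [MulAut.conj_apply, commutatorElement_def]
      group
    have hu : ∀ p q, p ≠ q → ∀ c ∈ A, Commute (x p q c) (x j m (r * b) * x i m b) :=
      fun p q hpq c hcA => (hc p q hpq j m hmj.symm c hcA _ hrb).mul_right
        (hc p q hpq i m hmi.symm c hcA b hb)
    rw [← mul_one b, hx.conj_eq_commutator hij hmi hmj, e]
    refine (hu i j hij a ha).mul_right (conj_iff ?_).inv_right
    rw [mul_inv_rev, map_mul, MulAut.mul_apply, ← hx.neg hmi, ← hx.neg hmj,
      hx.conj_left hmi hij hmj, map_mul, hx.conj_commute hmj hmj hmj.symm hmj,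
      hx.conj_commute hmj hij hij.symm hmj]
    exact (hu m j hmj _ (A.mul_mem_left _ ha)).mul_left (hu i j hij a ha)
  · apply conj_iff
    rw [← hx.neg hkl.symm]
    by_cases hki : k = i
    · subst hki
      have hlj : l ≠ j := fun hlj => h ⟨rfl, hlj.symm⟩
      rw [hx.conj_left hkl.symm hij hlj]
      exact (hc l j hlj _ _ hkl _ (A.mul_mem_left _ ha) b hb).mul_left
        (hc _ j hij _ _ hkl a ha b hb)
    by_cases hlj : l = j
    · subst hlj
      rw [hx.conj_right hij hkl.symm (Ne.symm hki)]
      exact (hc i k (Ne.symm hki) _ _ hkl _ (A.neg_mem (A.mul_mem_right _ ha)) b hb).mul_left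
        (hc i _ hij _ _ hkl a ha b hb)
    · rw [hx.conj_commute hkl.symm hij hki hlj]
      exact hc i j hij k l hkl a ha b hb

theorem commutator_familyNormal_eq_bot (hx : IsSteinbergFamily x) {A B : Ideal R}
    (hA : A.IsTwoSided) (hB : B.IsTwoSided)
    (hc : ∀ i j, i ≠ j → ∀ k l, k ≠ l → ∀ a ∈ A, ∀ b ∈ B, Commute (x i j a) (x k l b)) :
    ⁅familyNormal x A, familyNormal x B⁆ = ⊥ := by
  rw [Subgroup.commutator_eq_bot_iff_le_centralizer]
  refine Subgroup.normalClosure_le_normal ?_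
  rintro _ ⟨i, j, hij, a, ha, rfl⟩
  rw [hx.familyNormal_eq hB, conjSubgroup, Subgroup.centralizer_closure]
  rw [SetLike.mem_coe, Subgroup.mem_centralizer_iff]
  rintro _ ⟨k, l, hkl, b, hb, r, rfl⟩
  exact (hx.commute_conj hA hc hij hkl ha hb r).eq.symm

theorem commutator_familyNormal_le (hx : IsSteinbergFamily x) {A B : Ideal R}
    (hA : A.IsTwoSided) (hB : B.IsTwoSided) {D : Subgroup G} [D.Normal]
    (h : ∀ i j, i ≠ j → ∀ k l, k ≠ l → ∀ a ∈ A, ∀ b ∈ B, ⁅x i j a, x k l b⁆ ∈ D) :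
    ⁅familyNormal x A, familyNormal x B⁆ ≤ D := by
  have hbot := (hx.quotient D).commutator_familyNormal_eq_bot hA hB
    fun i j hij k l hkl a ha b hb => (commute_mk_iff D).2 (h i j hij k l hkl a ha b hb)
  have hle : ∀ I : Ideal R, familyNormal x I ≤
      (familyNormal (fun i j a => (x i j a : G ⧸ D)) I).comap (QuotientGroup.mk' D) := by
    intro I
    refine Subgroup.normalClosure_le_normal ?_
    rintro _ ⟨i, j, hij, a, ha, rfl⟩
    exact mem_familyNormal (fun i j a => (x i j a : G ⧸ D)) hij ha
  rw [Subgroup.commutator_le]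
  intro g hg k hk
  have := Subgroup.commutator_mem_commutator (Subgroup.mem_comap.1 (hle A hg))
    (Subgroup.mem_comap.1 (hle B hk))
  rwa [hbot, Subgroup.mem_bot, commutatorElement_eq_one_iff_commute, QuotientGroup.mk'_apply,
    QuotientGroup.mk'_apply, commute_mk_iff] at this

/-- The commutator of two elementary subgroups, by generators. -/
theorem commutator_familySubgroup_eq_closure (hx : IsSteinbergFamily x) {A B : Ideal R}
    (hA : A.IsTwoSided) (hB : B.IsTwoSided) :
    ⁅familySubgroup x A, familySubgroup x B⁆ =
        Subgroup.closure (familyNormal x (symmProd A B) ∪ elemCommutators x A B) ∧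
      ⁅familySubgroup x A, familySubgroup x B⁆ = ⁅familyNormal x A, familyNormal x B⁆ := by
  set N := familyNormal x (symmProd A B) with hN
  set D := Subgroup.closure (N ∪ elemCommutators x A B) with hD
  have hND : N ≤ D := fun g hg => Subgroup.subset_closure (.inl hg)
  have hle : D ≤ ⁅familySubgroup x A, familySubgroup x B⁆ := by
    refine (Subgroup.closure_le _).2 (Set.union_subset (hx.familyNormal_symmProd_le hA hB) ?_)
    rintro _ ⟨i, j, hij, a, ha, b, hb, rfl⟩
    exact Subgroup.commutator_mem_commutator (mem_familySubgroup x hij ha)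
      (mem_familySubgroup x hij.symm hb)
  -- Normality comes from centrality of the elementary commutators modulo N; it allows passing to
  -- the quotient by D, which closes the circle of inclusions.
  have hnormal : D.Normal := by
    refine hx.mem_normal_of_conj ?_
    rintro k l - s g (hg | hg)
    · exact hND ((familyNormal_normal x _).conj_mem g hg _)
    · have e : MulAut.conj (x k l s) g = ⁅x k l s, g⁆ * g := by
        rw [MulAut.conj_apply, commutatorElement_def]
        group
      rw [e]
      exact mul_mem (hND (hx.commutator_mem hA hB hg _)) (Subgroup.subset_closure (.inr hg))
  have hge : ⁅familyNormal x A, familyNormal x B⁆ ≤ D := by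
    refine hx.commutator_familyNormal_le hA hB ?_
    intro i j hij k l hkl a ha b hb
    have hab := mul_mem_symmProd ha hb
    by_cases hjk : j = k
    · subst hjk
      by_cases hil : i = l
      · subst hil
        exact Subgroup.subset_closure (.inr ⟨i, j, hij, a, ha, b, hb, rfl⟩)
      · rw [hx.comm hij hkl hil]
        exact hND (mem_familyNormal x hil hab.1)
    by_cases hil : i = l
    · subst hil
      rw [← commutatorElement_inv, hx.comm hkl hij (Ne.symm hjk)]
      exact inv_mem (hND (mem_familyNormal x (Ne.symm hjk) hab.2))
    · rw [commutatorElement_eq_one_iff_commute.2 (hx.commute hij hkl hjk hil a b)]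
      exact one_mem _
  have hmono := Subgroup.commutator_mono (familySubgroup_le_familyNormal x A)
    (familySubgroup_le_familyNormal x B)
  exact ⟨le_antisymm (hmono.trans hge) hle, le_antisymm hmono (hge.trans hle)⟩

theorem commutator_normal (hx : IsSteinbergFamily x) {A B : Ideal R}
    (hA : A.IsTwoSided) (hB : B.IsTwoSided) :
    ⁅familySubgroup x A, familySubgroup x B⁆.Normal := by
  rw [(hx.commutator_familySubgroup_eq_closure hA hB).2]
  infer_instance

theorem familySubgroup_symmProd_le (hx : IsSteinbergFamily x) {A B : Ideal R}
    (hA : A.IsTwoSided) (hB : B.IsTwoSided) :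
    familySubgroup x (symmProd A B) ≤ ⁅familySubgroup x A, familySubgroup x B⁆ :=
  (familySubgroup_le_familyNormal x _).trans (hx.familyNormal_symmProd_le hA hB)

/-! ### Triple and quadruple commutators -/

/-- Having the full normal closure of level C here is what lets `quadruple_commutator` use this
bound with C replaced by a symmetrised product. -/
theorem triple_commutator_le (hx : IsSteinbergFamily x) {A B C : Ideal R}
    (hA : A.IsTwoSided) (hB : B.IsTwoSided) (hC : C.IsTwoSided) :
    ⁅⁅familySubgroup x A, familySubgroup x B⁆, familyNormal x C⁆ ≤
      ⁅familySubgroup x (symmProd A B), familySubgroup x C⁆ := by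
  have hAB := isTwoSided_symmProd hA hB
  have hH := hx.commutator_normal hAB hC
  set H := ⁅familySubgroup x (symmProd A B), familySubgroup x C⁆ with hHdef
  rw [(hx.commutator_familySubgroup_eq_closure hA hB).1]
  have hN : ∀ g ∈ familyNormal x (symmProd A B), ∀ h ∈ familyNormal x C, ⁅g, h⁆ ∈ H := by
    rw [hHdef, (hx.commutator_familySubgroup_eq_closure hAB hC).2]
    exact fun g hg h hh => Subgroup.commutator_mem_commutator hg hh
  rw [hx.familyNormal_eq hC] at hN ⊢
  refine commutator_closure_le ?_
  rintro g (hg | ⟨i, j, hij, a, ha, b, hb, rfl⟩) t ht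
  · exact hN g hg t (Subgroup.subset_closure ht)
  -- Here y is the elementary commutator moved to (p,q) disjoint from (k,l); this is where four
  -- indices are needed.
  obtain ⟨z, hz, e⟩ : ∃ z ∈ familyNormal x (symmProd A B), ∃ y, Commute y t ∧
      ⁅x i j a, x j i b⁆ = y * z := by
    obtain ⟨k, l, hkl, c, hc, r, rfl⟩ := ht
    obtain ⟨p, q, hpq, hpk, hpl, hqk, hql⟩ := hx.exists_disjoint k l
    obtain ⟨z, hz, e⟩ := hx.exists_eq_mul hA hB hij hpq ha hb
    refine ⟨z, hz, _, ?_, e⟩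
    have h1 : ∀ {g : G}, Commute (x p q a) g → Commute (x q p b) g →
        Commute ⁅x p q a, x q p b⁆ g := fun h1 h2 =>
      ((h1.mul_left h2).mul_left h1.inv_left).mul_left h2.inv_left
    have h2 := h1 (hx.commute hpq hkl hqk hpl a c) (hx.commute hpq.symm hkl hpk hql b c)
    have h3 := h1 (hx.commute hpq hkl.symm hql hpk a r) (hx.commute hpq.symm hkl.symm hpl hqk b r)
    exact (h3.mul_right h2).mul_right h3.inv_right
  obtain ⟨y, hy, e⟩ := e
  rw [e, ← commute_mk_iff]
  exact (hy.map (QuotientGroup.mk' H)).mul_left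
    ((commute_mk_iff H).2 (hN z hz t (Subgroup.subset_closure ht)))

theorem triple_commutator (hx : IsSteinbergFamily x) {A B C : Ideal R}
    (hA : A.IsTwoSided) (hB : B.IsTwoSided) (hC : C.IsTwoSided) :
    ⁅⁅familySubgroup x A, familySubgroup x B⁆, familySubgroup x C⁆ =
      ⁅familySubgroup x (symmProd A B), familySubgroup x C⁆ :=
  le_antisymm
    ((Subgroup.commutator_mono le_rfl (familySubgroup_le_familyNormal x C)).trans
      (hx.triple_commutator_le hA hB hC))
    (Subgroup.commutator_mono (hx.familySubgroup_symmProd_le hA hB) le_rfl)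

theorem quadruple_commutator (hx : IsSteinbergFamily x) {A B C D : Ideal R}
    (hA : A.IsTwoSided) (hB : B.IsTwoSided) (hC : C.IsTwoSided) (hD : D.IsTwoSided) :
    ⁅⁅familySubgroup x A, familySubgroup x B⁆, ⁅familySubgroup x C, familySubgroup x D⁆⁆ =
      ⁅familySubgroup x (symmProd A B), familySubgroup x (symmProd C D)⁆ := by
  refine le_antisymm ?_ (Subgroup.commutator_mono (hx.familySubgroup_symmProd_le hA hB)
    (hx.familySubgroup_symmProd_le hC hD))
  have hAB := isTwoSided_symmProd hA hB
  have hCD := isTwoSided_symmProd hC hD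
  have hH := hx.commutator_normal hAB hCD
  have left := hx.triple_commutator_le hA hB hCD
  have right := hx.triple_commutator_le hC hD hAB
  rw [Subgroup.commutator_comm, Subgroup.commutator_comm (familySubgroup x (symmProd C D))] at right
  set H := ⁅familySubgroup x (symmProd A B), familySubgroup x (symmProd C D)⁆
  have eAB := (hx.commutator_familySubgroup_eq_closure hA hB).1
  have eCD := (hx.commutator_familySubgroup_eq_closure hC hD).1
  have hN : ∀ g ∈ ⁅familySubgroup x A, familySubgroup x B⁆,
      ∀ h ∈ familyNormal x (symmProd C D), ⁅g, h⁆ ∈ H :=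
    fun g hg h hh => left (Subgroup.commutator_mem_commutator hg hh)
  have hM : ∀ g ∈ familyNormal x (symmProd A B),
      ∀ h ∈ ⁅familySubgroup x C, familySubgroup x D⁆, ⁅g, h⁆ ∈ H :=
    fun g hg h hh => right (Subgroup.commutator_mem_commutator hg hh)
  rw [eAB] at hN ⊢
  rw [eCD] at hM ⊢
  refine commutator_closure_le ?_
  rintro g (hg | hg) t ht
  · exact hM g hg t (Subgroup.subset_closure ht)
  obtain (ht | ht) := ht
  · exact hN g (Subgroup.subset_closure (.inr hg)) t ht
  have ht' := Subgroup.subset_closure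
    (Set.mem_union_right (familyNormal x (symmProd C D) : Set G) ht)
  obtain ⟨i, j, hij, a, ha, b, hb, rfl⟩ := hg
  obtain ⟨k, l, hkl, c, hc, d, hd, rfl⟩ := ht
  -- Only two elementary commutators remain; moving the first to disjoint indices makes them commute
  -- up to z, which `hM` handles.
  obtain ⟨p, q, hpq, hpk, hpl, hqk, hql⟩ := hx.exists_disjoint k l
  obtain ⟨z, hz, e⟩ := hx.exists_eq_mul hA hB hij hpq ha hb
  have comm : ∀ {u v w : G}, Commute u w → Commute v w → Commute ⁅u, v⁆ w := fun h1 h2 =>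
    ((h1.mul_left h2).mul_left h1.inv_left).mul_left h2.inv_left
  have hy : Commute ⁅x p q a, x q p b⁆ ⁅x k l c, x l k d⁆ :=
    comm
      (comm (hx.commute hkl hpq hpl.symm hqk.symm c a)
        (hx.commute hkl.symm hpq hpk.symm hql.symm d a)).symm
      (comm (hx.commute hkl hpq.symm hql.symm hpk.symm c b)
        (hx.commute hkl.symm hpq.symm hqk.symm hpl.symm d b)).symm
  rw [e, ← commute_mk_iff]
  exact (hy.map (QuotientGroup.mk' H)).mul_left ((commute_mk_iff H).2 (hM z hz _ ht'))

end IsSteinbergFamily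

/-! ### Transvections as a Steinberg family -/

/-- The transvections, as elements of the group which they generate. -/
def transvectionFamily (R : Type*) [Ring R] (n : ℕ) (i j : Fin n) (a : R) :
    elemSubgroup n (⊤ : Ideal R) :=
  if h : i ≠ j then
    ⟨elemTransvection i j h a, Subgroup.subset_closure ⟨i, j, h, a, trivial, rfl⟩⟩
  -- The diagonal value is irrelevant: families are constrained only off the diagonal.
  else 1

theorem coe_transvectionFamily {R : Type*} [Ring R] {n : ℕ} {i j : Fin n} (h : i ≠ j) (a : R) :
    (transvectionFamily R n i j a : Matrix.GeneralLinearGroup (Fin n) R) =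
      elemTransvection i j h a := by
  rw [transvectionFamily, dif_pos h]

theorem map_subtype_familySubgroup {R : Type*} [Ring R] (n : ℕ) (A : Ideal R) :
    (familySubgroup (transvectionFamily R n) A).map (elemSubgroup n (⊤ : Ideal R)).subtype =
      elemSubgroup n A := by
  rw [familySubgroup, MonoidHom.map_closure]
  refine congrArg Subgroup.closure (Set.ext fun g => ?_)
  constructor
  · rintro ⟨_, ⟨i, j, hij, a, ha, rfl⟩, rfl⟩
    exact ⟨i, j, hij, a, ha, coe_transvectionFamily hij a⟩
  · rintro ⟨i, j, hij, a, ha, rfl⟩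
    exact ⟨_, ⟨i, j, hij, a, ha, rfl⟩, coe_transvectionFamily hij a⟩

theorem elemTransvection_add {R : Type*} [Ring R] {n : ℕ} {i j : Fin n} (hij : i ≠ j) (a b : R) :
    elemTransvection i j hij (a + b) = elemTransvection i j hij a * elemTransvection i j hij b := by
  ext1
  simp [elemTransvection, mul_add, add_mul, Matrix.single_mul_single_of_ne _ _ _ _ hij.symm,
    Matrix.single_add, add_assoc]

theorem elemTransvection_commute {R : Type*} [Ring R] {n : ℕ} {i j k l : Fin n} (hij : i ≠ j)
    (hkl : k ≠ l) (hjk : j ≠ k) (hil : i ≠ l) (a b : R) :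
    Commute (elemTransvection i j hij a) (elemTransvection k l hkl b) := by
  ext1
  simp [elemTransvection, mul_add, add_mul, Matrix.single_mul_single_of_ne _ _ _ _ hjk,
    Matrix.single_mul_single_of_ne _ _ _ _ hil.symm]
  abel

theorem elemTransvection_commutator {R : Type*} [Ring R] {n : ℕ} {i j k : Fin n} (hij : i ≠ j)
    (hjk : j ≠ k) (hik : i ≠ k) (a b : R) :
    ⁅elemTransvection i j hij a, elemTransvection j k hjk b⁆ = elemTransvection i k hik (a * b) := by
  rw [commutatorElement_def, mul_inv_eq_iff_eq_mul, mul_inv_eq_iff_eq_mul]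
  ext1
  simp [elemTransvection, mul_add, add_mul, Matrix.single_mul_single_of_ne _ _ _ _ hik.symm,
    Matrix.single_mul_single_of_ne _ _ _ _ hjk.symm]
  abel

theorem isSteinbergFamily_transvectionFamily (R : Type*) [Ring R] {n : ℕ} (hn : 4 ≤ n) :
    IsSteinbergFamily (transvectionFamily R n) where
  four_le := by rwa [Fintype.card_fin]
  add hij a b := by
    ext1
    simp only [Subgroup.coe_mul, coe_transvectionFamily hij, elemTransvection_add]
  comm hij hjk hik a b := by
    ext1
    simp only [commutatorElement_def, Subgroup.coe_mul, Subgroup.coe_inv,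
      coe_transvectionFamily hij, coe_transvectionFamily hjk, coe_transvectionFamily hik]
    rw [← elemTransvection_commutator hij hjk hik, commutatorElement_def]
  commute hij hkl hjk hil a b := by
    refine Subtype.ext ?_
    simp only [Subgroup.coe_mul, coe_transvectionFamily hij, coe_transvectionFamily hkl]
    exact elemTransvection_commute hij hkl hjk hil a b
  closure_eq_top := by
    have h := map_subtype_familySubgroup n (⊤ : Ideal R)
    rw [familySubgroup] at h
    apply Subgroup.map_injective (Subgroup.subtype_injective _)
    rw [← MonoidHom.range_eq_map, Subgroup.range_subtype]
    simpa using h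

theorem elemSubgroup_triple_commutator {R : Type*} [Ring R] {n : ℕ} (hn : 4 ≤ n) {A B C : Ideal R}
    (hA : A.IsTwoSided) (hB : B.IsTwoSided) (hC : C.IsTwoSided) :
    ⁅⁅elemSubgroup n A, elemSubgroup n B⁆, elemSubgroup n C⁆ =
      ⁅elemSubgroup n (symmProd A B), elemSubgroup n C⁆ := by
  simp only [← map_subtype_familySubgroup n, ← Subgroup.map_commutator,
    (isSteinbergFamily_transvectionFamily R hn).triple_commutator hA hB hC]

theorem elemSubgroup_quadruple_commutator {R : Type*} [Ring R] {n : ℕ} (hn : 4 ≤ n)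
    {A B C D : Ideal R} (hA : A.IsTwoSided) (hB : B.IsTwoSided) (hC : C.IsTwoSided)
    (hD : D.IsTwoSided) :
    ⁅⁅elemSubgroup n A, elemSubgroup n B⁆, ⁅elemSubgroup n C, elemSubgroup n D⁆⁆ =
      ⁅elemSubgroup n (symmProd A B), elemSubgroup n (symmProd C D)⁆ := by
  simp only [← map_subtype_familySubgroup n, ← Subgroup.map_commutator,
    (isSteinbergFamily_transvectionFamily R hn).quadruple_commutator hA hB hC hD]

/-! ### Induction on the bracketing -/

/-- `H` is either the elementary subgroup of level `X`, or the commutator of the elementary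
subgroups of levels `A` and `B`, where `X = A ∘ B`. -/
def IsElemOrCommutator {R : Type*} [Ring R] (n : ℕ)
    (H : Subgroup (Matrix.GeneralLinearGroup (Fin n) R)) (X : Ideal R) : Prop :=
  H = elemSubgroup n X ∨ ∃ A B : Ideal R, A.IsTwoSided ∧ B.IsTwoSided ∧
    H = ⁅elemSubgroup n A, elemSubgroup n B⁆ ∧ X = symmProd A B

theorem IsElemOrCommutator.commutator_eq {R : Type*} [Ring R] {n : ℕ} (hn : 4 ≤ n)
    {H K : Subgroup (Matrix.GeneralLinearGroup (Fin n) R)} {X Y : Ideal R}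
    (hX : X.IsTwoSided) (hY : Y.IsTwoSided) (hH : IsElemOrCommutator n H X)
    (hK : IsElemOrCommutator n K Y) :
    ⁅H, K⁆ = ⁅elemSubgroup n X, elemSubgroup n Y⁆ := by
  obtain rfl | ⟨A, B, hA, hB, rfl, rfl⟩ := hH <;> obtain rfl | ⟨C, D, hC, hD, rfl, rfl⟩ := hK
  · rfl
  · rw [Subgroup.commutator_comm, elemSubgroup_triple_commutator hn hC hD hX,
      Subgroup.commutator_comm]
  · exact elemSubgroup_triple_commutator hn hA hB hY
  · exact elemSubgroup_quadruple_commutator hn hA hB hC hD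

/-- A subbracket need not evaluate to an elementary subgroup, so the induction carries the
dichotomy: a leaf gives the first alternative, a node the second. -/
theorem isElemOrCommutator_eval {R : Type*} [Ring R] {n : ℕ} (hn : 4 ≤ n) {m : ℕ}
    (b : Bracketing m) (I : Fin m → Ideal R) (hI : ∀ i, (I i).IsTwoSided) :
    (b.eval symmProd I).IsTwoSided ∧
      IsElemOrCommutator n (b.eval (fun H K => ⁅H, K⁆) fun i => elemSubgroup n (I i))
        (b.eval symmProd I) := by
  induction b with
  | leaf => exact ⟨hI 0, .inl rfl⟩
  | node b c ihb ihc =>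
    obtain ⟨hb, hb'⟩ := ihb _ fun i => hI (Fin.castAdd _ i)
    obtain ⟨hc, hc'⟩ := ihc _ fun i => hI (Fin.natAdd _ i)
    exact ⟨isTwoSided_symmProd hb hc, .inr ⟨_, _, hb, hc, hb'.commutator_eq hn hb hc hc', rfl⟩⟩

theorem theorem1 {R : Type*} [Ring R] (n : ℕ) (hn : 4 ≤ n) {s t : ℕ}
    (b : Bracketing s) (c : Bracketing t)
    (I : Fin (s + t) → Ideal R) (hI : ∀ i, (I i).IsTwoSided) :
    (Bracketing.node b c).eval (fun H K => ⁅H, K⁆) (fun i => elemSubgroup n (I i)) =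
      ⁅elemSubgroup n (b.eval symmProd fun i => I (Fin.castAdd t i)),
        elemSubgroup n (c.eval symmProd fun i => I (Fin.natAdd s i))⁆ := by
  obtain ⟨hb, hb'⟩ := isElemOrCommutator_eval hn b _ fun i => hI (Fin.castAdd t i)
  obtain ⟨hc, hc'⟩ := isElemOrCommutator_eval hn c _ fun i => hI (Fin.natAdd s i)
  exact hb'.commutator_eq hn hb hc hc'
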